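/- Let $d\ge 1$, $\xi\in\mathbb{R}^d$, let $\bar\Omega$ be a positive definite $d\times d$ matrix, and let $\tilde f:[0,\infty)\to[0,\infty)$ be a density generator, i.e. a measurable function with $0<\int_{\mathbb{R}^d}\tilde f(\|y\|^2)\,dy<\infty$; put $c_d=\left(\int_{\mathbb{R}^d}\tilde f(\|y\|^2)\,dy\right)^{-1}$. Let $f(z)=c_d|\bar\Omega|^{-1/2}\tilde f\{(z-\xi)^\top\bar\Omega^{-1}(z-\xi)\}$ be the density of $U\sim \mathrm{Ell}_d(\xi,\bar\Omega,\tilde f)$. Let $X$ be a real random variable with distribution function $G$ such that $G(-x)=1-G(x)$ for all $x\in\mathbb{R}$, and let $w:\mathbb{R}^d\to\mathbb{R}$ be measurable with $w(-y)=-w(y)$ for all $y$. Let $Z$ be a random vector with density $2f(z)\,G\{w(z-\xi)\}$, $z\in\mathbb{R}^d$, and let $L$ be any $d\times d$ matrix with $L^\top L=\bar\Omega$. Write $w_L(y)=w(L^\top y)$. Then there are random variables $R>0$ and $S'$, on the probability space of $Z$, with $\|S'\|=1$ and $$Z=\xi+R\,L^\top S'\quad\text{almost surely,}$$ such that the following hold.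 (a) $R$ has the same distribution as the radius of $U$: if $S$ is uniform on the unit sphere of $\mathbb{R}^d$ and independent of a variable $R_0$ with the law of $R$, then $\xi+R_0L^\top S$ has the law of $U$; and whenever $\xi+R_0L_0^\top S$ has the law of $U$, with $L_0^\top L_0=\bar\Omega$, $S$ uniform on the unit sphere and $R_0>0$ almost surely and independent of $S$, then $R_0$ has the law of $R$. (b) Relative to the uniform distribution on the unit sphere, $S'$ has density $s\mapsto 2\Pr\{X\le w_L(Rs)\}$, where $X$ is independent of $R$. Hence $S'$ is in general not uniform: it is uniform if and only if $\Pr\{X\le w_L(Rs)\}=\tfrac12$ for almost every $s$ in the sphere. If $d\ge2$, then in spherical coordinates $s(\theta)=(\cos\theta_1,\ \sin\theta_1\cos\theta_2,\ \dots,\ \sin\theta_1\cdots\sin\theta_{d-2}\cos\theta_{d-1},\ \sin\theta_1\cdots\sin\theta_{d-1})$, with $\theta_k\in[0,\pi)$ for $k\le d-2$ and $\theta_{d-1}\in[0,2\pi)$, the density of $S'$ is $$\frac{\Gamma(d/2)}{\pi^{d/2}}\prod_{k=1}^{d-2}(\sin\theta_k)^{d-k-1}\,\Pr\{X\le w_L^*(\theta_1,\dots,\theta_{d-1},R)\},\qquad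 w_L^*(\theta,r)=w_L(r\,s(\theta)).$$ (c) For almost every $r$ with respect to the law of $R$, the conditional distribution of $S'$ given $R=r$ is again a perturbation of a centrally symmetric distribution of the same type: relative to the uniform distribution on the unit sphere, which is symmetric around $0$, it has density $s\mapsto 2\,G\{w_L(rs)\}$, where $s\mapsto w_L(rs)$ is odd. If $d\ge2$, its density in spherical coordinates is $$\frac{\Gamma(d/2)}{\pi^{d/2}}\prod_{k=1}^{d-2}(\sin\theta_k)^{d-k-1}\,G\{w_L^*(\theta_1,\dots,\theta_{d-1},r)\}.$$ -/

import Mathlib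

open MeasureTheory ProbabilityTheory Set Matrix

noncomputable section

/-- Euclidean space `ℝ^d`. -/
abbrev E (d : ℕ) : Type := EuclideanSpace ℝ (Fin d)

/-- The matrix-vector product `A x` on `ℝ^d`. -/
def act {d : ℕ} (A : Matrix (Fin d) (Fin d) ℝ) (x : E d) : E d :=
  WithLp.toLp 2 (A *ᵥ x.ofLp)

/-- The quadratic form `xᵀ A x`. -/
def quad {d : ℕ} (A : Matrix (Fin d) (Fin d) ℝ) (x : E d) : ℝ :=
  x.ofLp ⬝ᵥ (A *ᵥ x.ofLp)

/-- `ft : ℝ⁺ → ℝ⁺` generates a density on `ℝ^d`: `y ↦ ft (‖y‖²)` can be normalised. Only the values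
of `ft` on `[0, ∞)` are ever used. -/
structure IsDensityGenerator (d : ℕ) (ft : ℝ → ℝ) : Prop where
  measurable : Measurable ft
  nonneg : ∀ x, 0 ≤ x → 0 ≤ ft x
  integrable : Integrable (fun y : E d => ft (‖y‖ ^ 2)) volume
  pos : 0 < ∫ y : E d, ft (‖y‖ ^ 2)

/-- The normalising constant `c_d` of a density generator. -/
def normConst (d : ℕ) (ft : ℝ → ℝ) : ℝ := (∫ y : E d, ft (‖y‖ ^ 2))⁻¹

/-- The density of `Ell_d(ξ, Om, ft)`. -/
def ellDensity {d : ℕ} (ξ : E d) (Om : Matrix (Fin d) (Fin d) ℝ) (ft : ℝ → ℝ) (y : E d) : ℝ :=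
  normConst d ft / Real.sqrt Om.det * ft (quad Om⁻¹ (y - ξ))

/-- The distribution `Ell_d(ξ, Om, ft)`. -/
def ellLaw {d : ℕ} (ξ : E d) (Om : Matrix (Fin d) (Fin d) ℝ) (ft : ℝ → ℝ) : Measure (E d) :=
  volume.withDensity (fun y => ENNReal.ofReal (ellDensity ξ Om ft y))

/-- The uniform distribution on the unit sphere of `ℝ^d`, as a measure on `ℝ^d`: the normalised
surface measure. -/
def unifSphere (d : ℕ) : Measure (E d) :=
  (((volume : Measure (E d)).toSphere univ)⁻¹ • (volume : Measure (E d)).toSphere).map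
    (Subtype.val : Metric.sphere (0 : E d) 1 → E d)

/-- `ρ` is the law of a radius (generating variate) in a representation `ξ + R Lᵀ S` of the
distribution `μ`, where `R > 0` almost surely and `S` is uniform on the unit sphere and independent
of `R`. -/
def IsRadiusLaw {d : ℕ} (ξ : E d) (L : Matrix (Fin d) (Fin d) ℝ) (μ : Measure (E d))
    (ρ : Measure ℝ) : Prop :=
  IsProbabilityMeasure ρ ∧ ρ (Iic 0) = 0 ∧
    (ρ.prod (unifSphere d)).map (fun p => ξ + p.1 • act Lᵀ p.2) = μ

/-- `μ` is obtained from the probability distribution `μ₀`, centrally symmetric around `0`, by the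
perturbation `2 G(v)`, where `v` is odd: if `μ₀` has density `f` with respect to some measure, then
`μ` has density `2 f G(v)` with respect to it. -/
def IsSymmetricPerturbation {d : ℕ} (μ₀ : Measure (E d)) (G : ℝ → ℝ) (v : E d → ℝ)
    (μ : Measure (E d)) : Prop :=
  IsProbabilityMeasure μ₀ ∧ μ₀.map (fun y => -y) = μ₀ ∧
    Measurable v ∧ (∀ y, v (-y) = -v y) ∧
    IsProbabilityMeasure μ ∧ μ = μ₀.withDensity (fun y => ENNReal.ofReal (2 * G (v y)))

/-- The point of the unit sphere of `ℝ^d` with spherical coordinates `θ₁, …, θ_{d-1}`: its `j`-th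
coordinate is `sin θ₁ ⋯ sin θ_{j-1} cos θ_j` for `j < d`, and the last one is
`sin θ₁ ⋯ sin θ_{d-1}`. (Indices start from `0` in the code.) -/
def sphPoint {d : ℕ} (θ : Fin (d - 1) → ℝ) : E d :=
  WithLp.toLp 2 fun j : Fin d =>
    (∏ k : Fin (d - 1), if k.val < j.val then Real.sin (θ k) else 1) *
      (if h : j.val < d - 1 then Real.cos (θ ⟨j.val, h⟩) else 1)

/-- The range of the angles: `θ_k ∈ [0, π)` for `k ≤ d - 2`, and `θ_{d-1} ∈ [0, 2π)`. -/
def angleBox (d : ℕ) : Set (Fin (d - 1) → ℝ) :=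
  {θ | ∀ k : Fin (d - 1), θ k ∈ Ico 0 (if k.val + 1 = d - 1 then 2 * Real.pi else Real.pi)}

/-- The angular part `∏_{k=1}^{d-2} (sin θ_k)^{d-k-1}` of the Jacobian. (The index `k` in the code is
one less, and the factor for the last angle is `1`.) -/
def angleJacobian {d : ℕ} (θ : Fin (d - 1) → ℝ) : ℝ :=
  ∏ k : Fin (d - 1), Real.sin (θ k) ^ (d - 2 - k.val)

/-- In spherical coordinates, the distribution `μ` on the unit sphere has density `h`. -/
def HasSphericalDensity {d : ℕ} (μ : Measure (E d)) (h : (Fin (d - 1) → ℝ) → ℝ) : Prop :=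
  μ = ((volume.restrict (angleBox d)).withDensity (fun θ => ENNReal.ofReal (h θ))).map sphPoint

/-- `w_L(y) = w(Lᵀ y)`. -/
def wL {d : ℕ} (w : E d → ℝ) (L : Matrix (Fin d) (Fin d) ℝ) (y : E d) : ℝ := w (act Lᵀ y)

/-- `w_L^*(θ₁, …, θ_{d-1}, r)`: the function `w_L` in spherical coordinates. -/
def wLStar {d : ℕ} (w : E d → ℝ) (L : Matrix (Fin d) (Fin d) ℝ) (θ : Fin (d - 1) → ℝ) (r : ℝ) : ℝ :=
  wL w L (r • sphPoint θ)

end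

/-! Put `Y = (Lᵀ)⁻¹(Z - ξ)`. The affine change of variables turns the elliptical density into a
spherical one (`quad_inv_act`, `skewLaw_eq_map`), so `Y` has the spherical law perturbed by `2
G(w_L(y))`. The map `y ↦ (‖y‖, y/‖y‖)` carries Lebesgue measure to a product of a radial measure and
the uniform law (`volume_map_polarDecomp`). Hence `(R, S')` has density `2 G(w_L(rs))` relative to
`radiusLaw ⊗ unifSphere` (`exists_stochastic_representation`), and the claims about `R` and `S'` are
read off this joint law.

For fixed `r` the values of `G(w_L(rs))` at `s` and `-s` add up to one, and the uniform law is
symmetric, so the density integrates to one over the sphere (`lintegral_two_mul_cdf_odd`). Therefore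
`R` keeps the radius law of `U`, and the density at fixed `r` is a conditional density of `S'`.
Integrating out `r` gives the marginal of `S'`, and Fubini turns the integral of `G` into a
probability about `X`. The radius law is unique because the Mahalanobis distance recovers the radius
(`IsRadiusLaw.eq_map`).

The formulas in angles follow from integration in spherical coordinates (`lintegral_spherical`), by
measuring the same cone in two ways (`unifSphere_eq_map_sphPoint`). -/

/-! ### Planar polar coordinates and the recursion for the angles -/

section SphericalCoordinates

open scoped ENNReal

theorem lintegral_fin_succ {n : ℕ} {f : (Fin (n + 1) → ℝ) → ℝ≥0∞} (hf : Measurable f) :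
    ∫⁻ x, f x = ∫⁻ a : ℝ, ∫⁻ y : Fin n → ℝ, f (Fin.cons a y) := by
  have h := (volume_preserving_piFinSuccAbove (fun _ : Fin (n + 1) => ℝ) 0).symm
  rw [← h.lintegral_comp hf]
  refine (lintegral_prod _ (hf.comp (MeasurableEquiv.measurable _)).aemeasurable).trans ?_
  simp [MeasurableEquiv.piFinSuccAbove, Fin.insertNthEquiv]

/-- Polar coordinates in the upper half-plane. -/
theorem lintegral_upperHalfPlane_polar {g : ℝ × ℝ → ℝ≥0∞} (hg : Measurable g) :
    ∫⁻ x, ∫⁻ y in Ioi 0, g (x, y) = ∫⁻ r in Ioi 0, ∫⁻ φ in Ico 0 Real.pi,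
      ENNReal.ofReal r * g (r * Real.cos φ, r * Real.sin φ) := by
  have hS : MeasurableSet {p : ℝ × ℝ | 0 < p.2} := measurableSet_lt measurable_const measurable_snd
  have hgS := hg.indicator hS
  have hpol : Measurable fun p : ℝ × ℝ => (p.1 * Real.cos p.2, p.1 * Real.sin p.2) := by fun_prop
  calc ∫⁻ x, ∫⁻ y in Ioi 0, g (x, y)
      = ∫⁻ x, ∫⁻ y, {p : ℝ × ℝ | 0 < p.2}.indicator g (x, y) := by
        refine lintegral_congr fun x => ?_
        rw [← lintegral_indicator measurableSet_Ioi]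
        rfl
    _ = ∫⁻ p, {p : ℝ × ℝ | 0 < p.2}.indicator g p := (lintegral_prod _ hgS.aemeasurable).symm
    _ = ∫⁻ p in Ioi (0 : ℝ) ×ˢ Ioo (-Real.pi) Real.pi, ENNReal.ofReal p.1 *
          {p : ℝ × ℝ | 0 < p.2}.indicator g (p.1 * Real.cos p.2, p.1 * Real.sin p.2) :=
        (lintegral_comp_polarCoord_symm _).symm
    _ = ∫⁻ r in Ioi 0, ∫⁻ φ in Ioo (-Real.pi) Real.pi, ENNReal.ofReal r *
          {p : ℝ × ℝ | 0 < p.2}.indicator g (r * Real.cos φ, r * Real.sin φ) := by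
        rw [Measure.volume_eq_prod, ← Measure.prod_restrict]
        refine lintegral_prod _ (Measurable.aemeasurable ?_)
        exact (by fun_prop : Measurable fun p : ℝ × ℝ => ENNReal.ofReal p.1).mul (hgS.comp hpol)
    _ = _ := by
        refine setLIntegral_congr_fun measurableSet_Ioi fun r (hr : 0 < r) => ?_
        -- For `r > 0` the half-plane condition reads `0 < sin φ`, which on `(-π, π)` means `φ ∈ (0,
        -- π)`.
        rw [← setLIntegral_congr Ioo_ae_eq_Ico, ← lintegral_indicator measurableSet_Ioo,
          ← lintegral_indicator measurableSet_Ioo]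
        refine lintegral_congr fun φ => ?_
        simp only [indicator, mem_Ioo, mem_ofPred_eq, mul_pos_iff_of_pos_left hr]
        by_cases h1 : 0 < φ ∧ φ < Real.pi
        · rw [if_pos ⟨by linarith [Real.pi_pos], h1.2⟩, if_pos h1,
            if_pos (Real.sin_pos_of_pos_of_lt_pi h1.1 h1.2)]
        · rw [if_neg h1]
          split_ifs with h2 h3
          · exact absurd h3 (not_lt.2 (Real.sin_nonpos_of_nonpos_of_neg_pi_le
              (not_lt.1 fun h => h1 ⟨h, h2.2⟩) h2.1.le))
          · simp
          · rfl

/-- Polar coordinates in the plane, with the angle in `[0, 2π)`. -/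
theorem lintegral_plane_polar {g : ℝ × ℝ → ℝ≥0∞} (hg : Measurable g) :
    ∫⁻ p, g p = ∫⁻ r in Ioi 0, ∫⁻ φ in Ico 0 (2 * Real.pi),
      ENNReal.ofReal r * g (r * Real.cos φ, r * Real.sin φ) := by
  have hpol : Measurable fun p : ℝ × ℝ => (p.1 * Real.cos p.2, p.1 * Real.sin p.2) := by fun_prop
  calc ∫⁻ p, g p
      = ∫⁻ p in Ioi (0 : ℝ) ×ˢ Ioo (-Real.pi) Real.pi, ENNReal.ofReal p.1 *
          g (p.1 * Real.cos p.2, p.1 * Real.sin p.2) :=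
        (lintegral_comp_polarCoord_symm _).symm
    _ = ∫⁻ r in Ioi 0, ∫⁻ φ in Ioo (-Real.pi) Real.pi, ENNReal.ofReal r *
          g (r * Real.cos φ, r * Real.sin φ) := by
        rw [Measure.volume_eq_prod, ← Measure.prod_restrict]
        refine lintegral_prod _ (Measurable.aemeasurable ?_)
        exact (by fun_prop : Measurable fun p : ℝ × ℝ => ENNReal.ofReal p.1).mul (hg.comp hpol)
    _ = _ := by
        refine lintegral_congr fun r => ?_
        rw [setLIntegral_congr Ioo_ae_eq_Ioc, setLIntegral_congr Ico_ae_eq_Ioc]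
        -- `(-π, π]` and `(0, 2π]` are both fundamental domains for `2πℤ`, and the integrand is
        -- periodic.
        have h1 := isAddFundamentalDomain_Ioc Real.two_pi_pos (-Real.pi)
        have h2 := isAddFundamentalDomain_Ioc Real.two_pi_pos 0
        have := h1.setLIntegral_eq h2 (fun φ => ENNReal.ofReal r *
          g (r * Real.cos φ, r * Real.sin φ)) ?_
        · rwa [show -Real.pi + 2 * Real.pi = Real.pi by ring, zero_add] at this
        · rintro ⟨a, ha⟩ φ
          obtain ⟨k, rfl⟩ := AddSubgroup.mem_zmultiples_iff.1 ha
          simp only [AddSubgroup.mk_vadd, vadd_eq_add, add_comm _ φ, zsmul_eq_mul,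
            Real.cos_add_int_mul_two_pi, Real.sin_add_int_mul_two_pi]

theorem measurableSet_angleBox (d : ℕ) : MeasurableSet (angleBox d) := by
  have : angleBox d = Set.pi univ fun k : Fin (d - 1) =>
      Ico 0 (if k.val + 1 = d - 1 then 2 * Real.pi else Real.pi) := by
    ext; simp [angleBox]
  rw [this]
  exact MeasurableSet.univ_pi fun _ => measurableSet_Ico

theorem measurable_sphPoint {d : ℕ} : Measurable (sphPoint (d := d)) := by
  unfold sphPoint
  refine (PiLp.volume_preserving_toLp (Fin d)).measurable.comp (measurable_pi_lambda _ fun j => ?_)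
  refine Measurable.mul (Finset.measurable_prod _ fun k _ => ?_) ?_
  · split_ifs <;> fun_prop
  · split_ifs <;> fun_prop

theorem measurable_angleJacobian {d : ℕ} : Measurable (angleJacobian (d := d)) := by
  unfold angleJacobian
  fun_prop

theorem angleJacobian_nonneg {d : ℕ} {θ : Fin (d - 1) → ℝ} (hθ : θ ∈ angleBox d) :
    0 ≤ angleJacobian θ := by
  refine Finset.prod_nonneg fun k _ => ?_
  have hk := hθ k
  by_cases h : k.val + 1 = d - 1
  -- The last angle runs up to `2π`, where the sine changes sign, but its exponent is zero.
  · have : d - 2 - k.val = 0 := by omega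
    simp [this]
  · rw [if_neg h] at hk
    exact pow_nonneg (Real.sin_nonneg_of_nonneg_of_le_pi hk.1 hk.2.le) _

/-- Every coordinate after the first carries the factor `sin φ`; removing it leaves the point of one
dimension less. This drives the induction on the dimension. -/
theorem sphPoint_cons {n : ℕ} (φ : ℝ) (θ : Fin (n + 1) → ℝ) :
    (sphPoint (d := n + 3) (Fin.cons φ θ : Fin (n + 2) → ℝ)).ofLp =
      Fin.cons (Real.cos φ) (Real.sin φ • (sphPoint (d := n + 2) θ).ofLp) := by
  funext j
  refine Fin.cases ?_ (fun j => ?_) j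
  · simp only [sphPoint]
    rw [dif_pos (by simp), Finset.prod_eq_one fun k _ => if_neg (by simp), one_mul]
    rfl
  · simp only [sphPoint, Fin.cons_succ, Pi.smul_apply, smul_eq_mul]
    rw [← mul_assoc]
    congr 1
    · refine (Fin.prod_univ_succ (n := n + 1) _).trans ?_
      simp
    · by_cases h : j.val < n + 1
      · rw [dif_pos (by simp; omega), dif_pos (by simpa using h)]
        exact congrArg Real.cos (Fin.cons_succ (α := fun _ => ℝ) φ θ ⟨j.val, h⟩)
      · rw [dif_neg (by simp; omega), dif_neg (by simpa using h)]

theorem angleJacobian_cons {n : ℕ} (φ : ℝ) (θ : Fin (n + 1) → ℝ) :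
    angleJacobian (d := n + 3) (Fin.cons φ θ : Fin (n + 2) → ℝ) =
      Real.sin φ ^ (n + 1) * angleJacobian (d := n + 2) θ := by
  refine (Fin.prod_univ_succ (n := n + 1) _).trans ?_
  simp only [angleJacobian, Fin.cons_zero, Fin.cons_succ, Fin.val_zero, Fin.val_succ]
  congr 1
  refine Finset.prod_congr rfl fun k _ => ?_
  congr 1
  omega

/-- With at least two angles, the new first angle is never the last one, so its range is `[0, π)`.
For this reason the induction starts from dimension two. -/
theorem cons_mem_angleBox {n : ℕ} (φ : ℝ) (θ : Fin (n + 1) → ℝ) :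
    (Fin.cons φ θ : Fin (n + 2) → ℝ) ∈ angleBox (n + 3) ↔
      φ ∈ Ico 0 Real.pi ∧ θ ∈ angleBox (n + 2) := by
  refine (Fin.forall_fin_succ (n := n + 1)).trans (and_congr ?_ ?_)
  · simp
  · refine forall_congr' fun k => ?_
    simp

theorem setLIntegral_angleBox_succ {n : ℕ} {F : (Fin (n + 2) → ℝ) → ℝ≥0∞} (hF : Measurable F) :
    ∫⁻ θ in angleBox (n + 3), F θ =
      ∫⁻ φ in Ico 0 Real.pi, ∫⁻ θ in angleBox (n + 2), F (Fin.cons φ θ) := by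
  have hB := measurableSet_angleBox (n + 3)
  have hB' := measurableSet_angleBox (n + 2)
  rw [← lintegral_indicator hB, ← lintegral_indicator measurableSet_Ico]
  refine (lintegral_fin_succ (hF.indicator hB)).trans (lintegral_congr fun φ => ?_)
  by_cases hφ : φ ∈ Ico 0 Real.pi
  · rw [indicator_of_mem hφ, ← lintegral_indicator hB']
    refine lintegral_congr fun θ => ?_
    by_cases hθ : θ ∈ angleBox (n + 2)
    · rw [indicator_of_mem hθ, indicator_of_mem ((cons_mem_angleBox φ θ).2 ⟨hφ, hθ⟩)]
    · rw [indicator_of_notMem hθ, indicator_of_notMem fun h => hθ ((cons_mem_angleBox φ θ).1 h).2]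
  · rw [indicator_of_notMem hφ]
    refine (lintegral_congr fun θ => ?_).trans lintegral_zero
    exact indicator_of_notMem (fun h => hφ ((cons_mem_angleBox φ θ).1 h).1) _

end SphericalCoordinates

/-! ### Integration in spherical coordinates -/

section SphericalIntegral

open scoped ENNReal

theorem sphPoint_two (θ : Fin 1 → ℝ) :
    (sphPoint (d := 2) θ).ofLp = ![Real.cos (θ 0), Real.sin (θ 0)] := by
  funext j
  fin_cases j
  · simp [sphPoint]
  · simp [sphPoint]

theorem angleJacobian_two (θ : Fin 1 → ℝ) : angleJacobian (d := 2) θ = 1 := by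
  simp [angleJacobian]

theorem setLIntegral_angleBox_two {F : (Fin 1 → ℝ) → ℝ≥0∞} :
    ∫⁻ θ in angleBox 2, F θ = ∫⁻ φ in Ico 0 (2 * Real.pi), F fun _ => φ := by
  have h := (volume_preserving_funUnique (Fin 1) ℝ).symm
  have hB : (MeasurableEquiv.funUnique (Fin 1) ℝ).symm ⁻¹' angleBox 2 = Ico 0 (2 * Real.pi) := by
    ext φ
    exact Fin.forall_fin_one
  have := h.setLIntegral_comp_preimage_emb (MeasurableEquiv.measurableEmbedding _) F (angleBox 2)
  rw [hB] at this
  exact this.symm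

/-- Integration in spherical coordinates. -/
theorem lintegral_spherical (n : ℕ) {f : (Fin (n + 2) → ℝ) → ℝ≥0∞} (hf : Measurable f) :
    ∫⁻ x, f x = ∫⁻ r in Ioi 0, ∫⁻ θ in angleBox (n + 2), ENNReal.ofReal (r ^ (n + 1)) *
      (ENNReal.ofReal (angleJacobian θ) * f (r • (sphPoint θ).ofLp)) := by
  induction n with
  | zero =>
    have h := (volume_preserving_finTwoArrow ℝ).symm
    rw [← h.lintegral_comp hf]
    refine (lintegral_plane_polar (hf.comp (MeasurableEquiv.measurable _))).trans ?_
    refine lintegral_congr fun r => ?_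
    rw [setLIntegral_angleBox_two]
    refine lintegral_congr fun φ => ?_
    simp only [zero_add, pow_one]
    rw [angleJacobian_two, sphPoint_two]
    simp [MeasurableEquiv.finTwoArrow, MeasurableEquiv.piFinTwo]
  | succ n ih =>
    have hcons : ∀ {α : Type} [MeasurableSpace α] {a : α → ℝ} {y : α → Fin (n + 2) → ℝ},
        Measurable a → Measurable y → Measurable fun z => (Fin.cons (a z) (y z) : Fin (n + 3) → ℝ) := by
      intro α _ a y ha hy
      refine measurable_pi_lambda _ fun j => ?_
      refine Fin.cases ?_ (fun j => ?_) j
      · simpa using ha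
      · simpa using hy.eval
    have hsph : Measurable fun θ => (sphPoint (d := n + 2) θ).ofLp :=
      (EuclideanSpace.volume_preserving_symm_measurableEquiv_toLp (Fin (n + 2))).measurable.comp
        measurable_sphPoint
    have hJ : Measurable (angleJacobian (d := n + 2)) := measurable_angleJacobian
    -- Split off the first coordinate `a`, apply the induction hypothesis to the others with radius
    -- `ρ`, then use polar coordinates `a = r cos φ`, `ρ = r sin φ` in the half-plane `ρ > 0`. The
    -- powers combine as `r · ρ^(n+1) = r^(n+2) (sin φ)^(n+1)`.
    calc ∫⁻ x, f x
        = ∫⁻ a : ℝ, ∫⁻ y : Fin (n + 2) → ℝ, f (Fin.cons a y) := lintegral_fin_succ hf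
      _ = ∫⁻ a : ℝ, ∫⁻ ρ in Ioi 0, ∫⁻ θ in angleBox (n + 2), ENNReal.ofReal (ρ ^ (n + 1)) *
            (ENNReal.ofReal (angleJacobian θ) *
              f (Fin.cons a (ρ • (sphPoint θ).ofLp))) := by
          refine lintegral_congr fun a => ih ?_
          exact hf.comp (hcons measurable_const measurable_id)
      _ = ∫⁻ r in Ioi 0, ∫⁻ φ in Ico 0 Real.pi, ENNReal.ofReal r *
            ∫⁻ θ in angleBox (n + 2), ENNReal.ofReal ((r * Real.sin φ) ^ (n + 1)) *
            (ENNReal.ofReal (angleJacobian θ) *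
              f (Fin.cons (r * Real.cos φ) ((r * Real.sin φ) • (sphPoint θ).ofLp))) := by
          refine lintegral_upperHalfPlane_polar (g := fun p => ∫⁻ θ in angleBox (n + 2),
            ENNReal.ofReal (p.2 ^ (n + 1)) * (ENNReal.ofReal (angleJacobian θ) *
              f (Fin.cons p.1 (p.2 • (sphPoint θ).ofLp)))) ?_
          refine Measurable.lintegral_prod_right' (f := fun q : (ℝ × ℝ) × (Fin (n + 1) → ℝ) =>
            ENNReal.ofReal (q.1.2 ^ (n + 1)) * (ENNReal.ofReal (angleJacobian (d := n + 2) q.2) *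
              f (Fin.cons q.1.1 (q.1.2 • (sphPoint (d := n + 2) q.2).ofLp)))) ?_
          refine Measurable.mul (by fun_prop) (Measurable.mul ?_ (hf.comp (hcons ?_ ?_)))
          · exact (hJ.comp measurable_snd).ennreal_ofReal
          · exact measurable_fst.comp measurable_fst
          · exact Measurable.smul (measurable_snd.comp measurable_fst) (hsph.comp measurable_snd)
      _ = _ := by
          refine setLIntegral_congr_fun measurableSet_Ioi fun r (hr : 0 < r) => ?_
          rw [setLIntegral_angleBox_succ]
          · refine setLIntegral_congr_fun measurableSet_Ico fun φ hφ => ?_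
            have hs : 0 ≤ Real.sin φ := Real.sin_nonneg_of_nonneg_of_le_pi hφ.1 hφ.2.le
            simp only
            rw [← lintegral_const_mul']
            · refine lintegral_congr fun θ => ?_
              have hr' : r • (Fin.cons (Real.cos φ) (Real.sin φ • (sphPoint (d := n + 2) θ).ofLp) :
                  Fin (n + 3) → ℝ) = Fin.cons (r * Real.cos φ)
                    ((r * Real.sin φ) • (sphPoint (d := n + 2) θ).ofLp) := by
                funext j
                refine Fin.cases ?_ (fun j => ?_) j
                · simp
                · simp [mul_assoc]
              rw [angleJacobian_cons, sphPoint_cons, mul_pow, ENNReal.ofReal_mul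
                (pow_nonneg hs _), ENNReal.ofReal_mul (pow_nonneg hr.le _), pow_succ r (n + 1),
                ENNReal.ofReal_mul (pow_nonneg hr.le _), hr']
              ring
            · exact ENNReal.ofReal_ne_top
          · refine Measurable.mul measurable_const (Measurable.mul ?_ (hf.comp ?_))
            · exact measurable_angleJacobian.ennreal_ofReal
            · refine Measurable.const_smul ?_ r
              exact (EuclideanSpace.volume_preserving_symm_measurableEquiv_toLp
                (Fin (n + 3))).measurable.comp measurable_sphPoint

theorem norm_sphPoint (n : ℕ) (θ : Fin (n + 1) → ℝ) : ‖sphPoint (d := n + 2) θ‖ = 1 := by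
  rw [EuclideanSpace.norm_eq, Real.sqrt_eq_one]
  simp only [Real.norm_eq_abs, sq_abs]
  induction n with
  | zero => simp [sphPoint_two]
  | succ n ih =>
    have h := sphPoint_cons (θ 0) (Fin.tail θ)
    rw [Fin.cons_self_tail] at h
    rw [h, Fin.sum_univ_succ]
    simp only [Fin.cons_zero, Fin.cons_succ, Pi.smul_apply, smul_eq_mul, mul_pow,
      ← Finset.mul_sum, ih, mul_one, Real.cos_sq_add_sin_sq]

end SphericalIntegral

/-! ### The uniform distribution on the sphere -/

section UniformSphere

open scoped ENNReal

theorem toSphere_univ_eq {d : ℕ} (hd : 1 ≤ d) :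
    (volume : Measure (E d)).toSphere univ =
      ENNReal.ofReal (2 * Real.pi ^ ((d : ℝ) / 2) / Real.Gamma (d / 2)) := by
  have : Nonempty (Fin d) := ⟨⟨0, hd⟩⟩
  have hd' : (0 : ℝ) < d / 2 := by positivity
  rw [Measure.toSphere_apply_univ, EuclideanSpace.volume_ball]
  simp only [finrank_euclideanSpace, Fintype.card_fin, ENNReal.ofReal_one, one_pow, one_mul]
  rw [← ENNReal.ofReal_natCast, ← ENNReal.ofReal_mul (by positivity), Real.Gamma_add_one hd'.ne',
    Real.sqrt_eq_rpow, ← Real.rpow_natCast, ← Real.rpow_mul Real.pi_pos.le]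
  congr 1
  have := (Real.Gamma_pos_of_pos hd').ne'
  rw [show 1 / 2 * (d : ℝ) = d / 2 by ring]
  field_simp

theorem toSphere_univ_ne_zero {d : ℕ} (hd : 1 ≤ d) :
    (volume : Measure (E d)).toSphere univ ≠ 0 := by
  have hd' : (0 : ℝ) < d / 2 := by positivity
  have := Real.Gamma_pos_of_pos hd'
  rw [toSphere_univ_eq hd, ENNReal.ofReal_ne_zero_iff]
  positivity

theorem toSphere_map_val {d : ℕ} (hd : 1 ≤ d) :
    (volume : Measure (E d)).toSphere.map (Subtype.val : Metric.sphere (0 : E d) 1 → E d) =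
      (volume : Measure (E d)).toSphere univ • unifSphere d := by
  rw [unifSphere, Measure.map_smul, smul_smul, ENNReal.mul_inv_cancel (toSphere_univ_ne_zero hd)
    (measure_ne_top _ _), one_smul]

theorem isProbabilityMeasure_unifSphere {d : ℕ} (hd : 1 ≤ d) :
    IsProbabilityMeasure (unifSphere d) := by
  constructor
  rw [unifSphere, Measure.map_apply measurable_subtype_coe .univ, preimage_univ,
    Measure.smul_apply, smul_eq_mul,
    ENNReal.inv_mul_cancel (toSphere_univ_ne_zero hd) (measure_ne_top _ _)]

instance instSFiniteUnifSphere (d : ℕ) : SFinite (unifSphere d) := by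
  unfold unifSphere
  infer_instance

theorem ae_norm_unifSphere (d : ℕ) : ∀ᵐ s ∂unifSphere d, ‖s‖ = 1 := by
  rw [unifSphere, ae_map_iff measurable_subtype_coe.aemeasurable
    (measurableSet_eq_fun measurable_norm measurable_const)]
  exact Filter.Eventually.of_forall fun s => by simp

/-- The polar decomposition `y ↦ (‖y‖, y / ‖y‖)`. -/
noncomputable def polarDecomp {d : ℕ} (y : E d) : ℝ × E d := (‖y‖, ‖y‖⁻¹ • y)

theorem measurable_polarDecomp {d : ℕ} : Measurable (polarDecomp (d := d)) := by
  unfold polarDecomp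
  fun_prop

/-- The measure with density `r ^ (d - 1)` on `(0, ∞)`, times the surface area of the sphere. -/
noncomputable def radialMeasure (d : ℕ) : Measure ℝ :=
  (volume : Measure (E d)).toSphere univ •
    (volume.restrict (Ioi 0)).withDensity fun r => ENNReal.ofReal (r ^ (d - 1))

instance instSFiniteRadialMeasure (d : ℕ) : SFinite (radialMeasure d) := by
  unfold radialMeasure
  infer_instance

theorem volumeIoiPow_map_val (n : ℕ) :
    (Measure.volumeIoiPow n).map (Subtype.val : Ioi (0 : ℝ) → ℝ) =
      (volume.restrict (Ioi 0)).withDensity fun r => ENNReal.ofReal (r ^ n) := by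
  have hm : Measurable fun r : ℝ => ENNReal.ofReal (r ^ n) := by fun_prop
  ext s hs
  rw [Measure.map_apply measurable_subtype_coe hs, Measure.volumeIoiPow,
    withDensity_apply _ (measurable_subtype_coe hs), withDensity_apply _ hs,
    ← map_comap_subtype_coe measurableSet_Ioi, setLIntegral_map hs hm measurable_subtype_coe]

/-- This is the polar homeomorphism of the punctured space; the origin, where `polarDecomp` takes
the value `(0, 0)`, is a null set. -/
theorem volume_map_polarDecomp {d : ℕ} (hd : 1 ≤ d) :
    (volume : Measure (E d)).map polarDecomp = (radialMeasure d).prod (unifSphere d) := by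
  have : Nonempty (Fin d) := ⟨⟨0, hd⟩⟩
  have h := (Measure.measurePreserving_homeomorphUnitSphereProd (volume : Measure (E d))).map_eq
  have h2 := congrArg (fun m => (m.map Prod.swap).map (Prod.map (Subtype.val : Ioi (0 : ℝ) → ℝ)
      (Subtype.val : Metric.sphere (0 : E d) 1 → E d))) h
  simp only [Measure.prod_swap] at h2
  rw [← Measure.map_prod_map _ _ measurable_subtype_coe measurable_subtype_coe,
    volumeIoiPow_map_val, toSphere_map_val hd, finrank_euclideanSpace, Fintype.card_fin,
    Measure.prod_smul_right, Measure.map_map (by fun_prop) (Homeomorph.measurable _),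
    Measure.map_map (by fun_prop) (by fun_prop)] at h2
  rw [radialMeasure, Measure.prod_smul_left, ← h2]
  have h3 : (volume : Measure (E d)) =
      (Measure.comap (Subtype.val : ({0}ᶜ : Set (E d)) → E d) volume).map Subtype.val := by
    rw [map_comap_subtype_coe (measurableSet_singleton _).compl]
    exact (Measure.restrict_eq_self_of_ae_mem (Measure.ae_ne volume 0)).symm
  conv_lhs => rw [h3]
  rw [Measure.map_map measurable_polarDecomp measurable_subtype_coe]
  congr 1
  funext y
  refine Prod.ext ?_ ?_ <;> simp [polarDecomp]

/-- The set `Iio 1` has finite nonzero radial mass, so testing on `Iio 1 ×ˢ A` allows the radial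
factor of a product to be cancelled. -/
theorem radialMeasure_Iio_one {d : ℕ} (hd : 1 ≤ d) :
    radialMeasure d (Iio 1) = volume (Metric.ball (0 : E d) 1) := by
  have := isProbabilityMeasure_unifSphere hd
  have h := congrArg (fun m => m (Iio 1 ×ˢ univ)) (volume_map_polarDecomp hd)
  simp only [Measure.prod_prod, measure_univ, mul_one] at h
  rw [← h, Measure.map_apply measurable_polarDecomp (measurableSet_Iio.prod .univ)]
  congr 1
  ext y
  simp [polarDecomp]

theorem radialMeasure_Iio_one_ne_zero {d : ℕ} (hd : 1 ≤ d) : radialMeasure d (Iio 1) ≠ 0 := by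
  rw [radialMeasure_Iio_one hd]
  exact (Metric.measure_ball_pos _ _ one_pos).ne'

theorem radialMeasure_Iio_one_ne_top {d : ℕ} (hd : 1 ≤ d) : radialMeasure d (Iio 1) ≠ ⊤ := by
  rw [radialMeasure_Iio_one hd]
  exact measure_ball_lt_top.ne

/-- Lebesgue measure is invariant under negation, which in polar form fixes the radius and negates
the direction. -/
theorem map_neg_unifSphere (d : ℕ) : (unifSphere d).map (fun y => -y) = unifSphere d := by
  rcases Nat.eq_zero_or_pos d with rfl | hd
  · have : (fun y : E 0 => -y) = id := funext fun y => Subsingleton.elim _ _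
    rw [this, Measure.map_id]
  have hnegE : (volume : Measure (E d)).map (fun y => -y) = volume :=
    (Measure.measurePreserving_neg _).map_eq
  have key : ((radialMeasure d).prod (unifSphere d)).map (Prod.map id fun y => -y) =
      (radialMeasure d).prod (unifSphere d) := by
    rw [← volume_map_polarDecomp hd]
    conv_rhs => rw [← hnegE]
    rw [Measure.map_map (by fun_prop) measurable_polarDecomp,
      Measure.map_map measurable_polarDecomp (by fun_prop)]
    congr 1
    ext y <;> simp [polarDecomp]
  ext A hA
  have h := congrArg (fun m => m (Iio 1 ×ˢ A)) key
  rw [← Measure.map_prod_map _ _ measurable_id measurable_neg, Measure.map_id,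
    Measure.prod_prod, Measure.prod_prod] at h
  exact (ENNReal.mul_right_inj (radialMeasure_Iio_one_ne_zero hd)
    (radialMeasure_Iio_one_ne_top hd)).1 h

/-- The uniform distribution on the unit sphere in spherical coordinates. -/
theorem unifSphere_eq_map_sphPoint {d : ℕ} (hd : 2 ≤ d) :
    unifSphere d = ((volume.restrict (angleBox d)).withDensity fun θ =>
      ENNReal.ofReal (Real.Gamma (d / 2) / (2 * Real.pi ^ ((d : ℝ) / 2)) *
        angleJacobian θ)).map sphPoint := by
  have hd1 : 1 ≤ d := by omega
  have hJ : Measurable fun θ => ENNReal.ofReal (angleJacobian (d := d) θ) :=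
    measurable_angleJacobian.ennreal_ofReal
  have hΓ : 0 < Real.Gamma ((d : ℝ) / 2) := Real.Gamma_pos_of_pos (by positivity)
  set c := ∫⁻ r in Ioi (0 : ℝ), ENNReal.ofReal (r ^ (d - 1)) * (Iio 1).indicator 1 r with hc
  have hrad : radialMeasure d (Iio 1) = (volume : Measure (E d)).toSphere univ * c := by
    rw [radialMeasure, Measure.smul_apply, smul_eq_mul, ← lintegral_indicator_one measurableSet_Iio,
      lintegral_withDensity_eq_lintegral_mul _ (by fun_prop)
        (measurable_one.indicator measurableSet_Iio)]
    rfl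
  have hS0 := toSphere_univ_ne_zero hd1
  have hc0 : c ≠ 0 := fun h => radialMeasure_Iio_one_ne_zero hd1 (by rw [hrad, h, mul_zero])
  have hct : c ≠ ⊤ := fun h => radialMeasure_Iio_one_ne_top hd1 (by
    rw [hrad, h, ENNReal.mul_top hS0])
  ext A hA
  set M := ∫⁻ θ in angleBox d, ENNReal.ofReal (angleJacobian θ) * A.indicator 1 (sphPoint θ) with hM
  have hAm : Measurable (A.indicator (1 : E d → ℝ≥0∞)) := measurable_one.indicator hA
  have hAs : Measurable fun θ => A.indicator (1 : E d → ℝ≥0∞) (sphPoint θ) :=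
    hAm.comp measurable_sphPoint
  have hJA : Measurable fun θ => ENNReal.ofReal (angleJacobian θ) *
      A.indicator (1 : E d → ℝ≥0∞) (sphPoint θ) := hJ.mul hAs
  have hIm : Measurable ((Iio (1 : ℝ)).indicator (1 : ℝ → ℝ≥0∞)) :=
    measurable_one.indicator measurableSet_Iio
  -- The volume of the cone over `A` in the unit ball is computed by `polarDecomp` here and by the
  -- angles in `hsph`; the common radial factor `c` then cancels.
  have hpol : ∫⁻ y : E d, (Iio 1).indicator 1 ‖y‖ * A.indicator 1 (‖y‖⁻¹ • y) =
      (volume : Measure (E d)).toSphere univ * c * unifSphere d A := by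
    rw [← hrad, ← Measure.prod_prod, ← volume_map_polarDecomp hd1,
      ← lintegral_indicator_one (measurableSet_Iio.prod hA),
      lintegral_map (measurable_one.indicator (measurableSet_Iio.prod hA)) measurable_polarDecomp]
    refine lintegral_congr fun y => ?_
    rw [← Set.indicator_prod_one]
    rfl
  have hsph : ∫⁻ y : E d, (Iio 1).indicator 1 ‖y‖ * A.indicator 1 (‖y‖⁻¹ • y) = c * M := by
    obtain ⟨n, rfl⟩ := Nat.exists_eq_add_of_le' hd
    have hm : Measurable fun y : E (n + 2) =>
        (Iio (1 : ℝ)).indicator (1 : ℝ → ℝ≥0∞) ‖y‖ * A.indicator 1 (‖y‖⁻¹ • y) :=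
      (hIm.comp measurable_norm).mul (hAm.comp (by fun_prop))
    have hto := PiLp.volume_preserving_toLp (Fin (n + 2))
    rw [← hto.lintegral_comp hm, lintegral_spherical n (f := fun x =>
        (Iio (1 : ℝ)).indicator (1 : ℝ → ℝ≥0∞) ‖(WithLp.toLp 2 x : E (n + 2))‖ * A.indicator 1 (‖(WithLp.toLp 2 x : E (n + 2))‖⁻¹ •
          (WithLp.toLp 2 x : E (n + 2)))) (hm.comp hto.measurable), hc,
      ← lintegral_mul_const _ (by fun_prop)]
    refine setLIntegral_congr_fun measurableSet_Ioi fun r (hr : 0 < r) => ?_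
    rw [hM, ← lintegral_const_mul _ hJA]
    refine lintegral_congr fun θ => ?_
    have h1 : WithLp.toLp 2 (r • (sphPoint (d := n + 2) θ).ofLp) = r • sphPoint (d := n + 2) θ := rfl
    have h2 : ‖r • sphPoint (d := n + 2) θ‖ = r := by
      rw [norm_smul, norm_sphPoint, mul_one, Real.norm_of_nonneg hr.le]
    rw [h1, h2, inv_smul_smul₀ hr.ne', Nat.add_sub_assoc (by norm_num)]
    ring
  have hmain : (volume : Measure (E d)).toSphere univ * unifSphere d A = M := by
    rw [← ENNReal.mul_right_inj hc0 hct, ← hsph, hpol]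
    ring
  have hk : ENNReal.ofReal (Real.Gamma (d / 2) / (2 * Real.pi ^ ((d : ℝ) / 2))) =
      ((volume : Measure (E d)).toSphere univ)⁻¹ := by
    rw [toSphere_univ_eq hd1, ← ENNReal.ofReal_inv_of_pos (by positivity), inv_div]
  have hk' : ∀ θ : Fin (d - 1) → ℝ, ENNReal.ofReal (Real.Gamma (d / 2) /
      (2 * Real.pi ^ ((d : ℝ) / 2)) * angleJacobian θ) =
      ((volume : Measure (E d)).toSphere univ)⁻¹ * ENNReal.ofReal (angleJacobian θ) := fun θ => by
    rw [ENNReal.ofReal_mul (by positivity), hk]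
  simp only [hk']
  symm
  rw [← lintegral_indicator_one hA, lintegral_map hAm measurable_sphPoint,
    lintegral_withDensity_eq_lintegral_mul _ (hJ.const_mul _) hAs]
  simp only [Pi.mul_apply, mul_assoc]
  rw [lintegral_const_mul _ hJA, ← hM, ← hmain, ← mul_assoc,
    ENNReal.inv_mul_cancel hS0 (measure_ne_top _ _), one_mul]

end UniformSphere

/-! ### The affine map `y ↦ ξ + Lᵀ y` -/

section LinearChange

open scoped ENNReal

variable {d : ℕ}

theorem act_eq_toEuclideanLin (A : Matrix (Fin d) (Fin d) ℝ) (x : E d) :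
    act A x = Matrix.toEuclideanLin A x := rfl

theorem measurable_act (A : Matrix (Fin d) (Fin d) ℝ) : Measurable (act A) :=
  (LinearMap.continuous_of_finiteDimensional (Matrix.toEuclideanLin A)).measurable

theorem act_act (A B : Matrix (Fin d) (Fin d) ℝ) (x : E d) : act A (act B x) = act (A * B) x := by
  simp [act, Matrix.mulVec_mulVec]

theorem act_one (x : E d) : act (1 : Matrix (Fin d) (Fin d) ℝ) x = x := by
  simp [act]

theorem act_smul (A : Matrix (Fin d) (Fin d) ℝ) (r : ℝ) (x : E d) :
    act A (r • x) = r • act A x := by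
  simp only [act_eq_toEuclideanLin, map_smul]

theorem act_neg (A : Matrix (Fin d) (Fin d) ℝ) (x : E d) : act A (-x) = -act A x := by
  simp only [act_eq_toEuclideanLin, map_neg]

theorem det_toEuclideanLin (A : Matrix (Fin d) (Fin d) ℝ) :
    LinearMap.det (Matrix.toEuclideanLin A) = A.det := by
  rw [Matrix.toEuclideanLin_eq_toLin_orthonormal, LinearMap.det_toLin]

theorem measurable_quad (A : Matrix (Fin d) (Fin d) ℝ) : Measurable (quad A) := by
  unfold quad dotProduct mulVec dotProduct
  fun_prop

variable {Om L : Matrix (Fin d) (Fin d) ℝ}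

theorem sqrt_det_eq_abs_det (hL : Lᵀ * L = Om) : Real.sqrt Om.det = |L.det| := by
  rw [← hL, Matrix.det_mul, Matrix.det_transpose, Real.sqrt_mul_self_eq_abs]

theorem det_ne_zero_of_posDef (hOm : Om.PosDef) (hL : Lᵀ * L = Om) : L.det ≠ 0 := by
  intro h
  have := hOm.det_pos
  rw [← hL, Matrix.det_mul, h, mul_zero] at this
  exact lt_irrefl _ this

/-- `Om⁻¹ = L⁻¹ (Lᵀ)⁻¹`, so the factors `L` and `Lᵀ` from the two arguments cancel. -/
theorem quad_inv_act (hOm : Om.PosDef) (hL : Lᵀ * L = Om) (y : E d) :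
    quad Om⁻¹ (act Lᵀ y) = ‖y‖ ^ 2 := by
  have hdet := det_ne_zero_of_posDef hOm hL
  have hu : IsUnit L.det := isUnit_iff_ne_zero.2 hdet
  have hu' : IsUnit Lᵀ.det := by rwa [Matrix.det_transpose]
  rw [EuclideanSpace.real_norm_sq_eq, quad, act, ← hL, Matrix.mul_inv_rev]
  simp only [Matrix.mulVec_mulVec]
  rw [Matrix.dotProduct_mulVec, Matrix.vecMul_mulVec, ← Matrix.dotProduct_mulVec,
    Matrix.transpose_transpose, ← Matrix.mul_assoc, ← Matrix.mul_assoc, Matrix.mul_nonsing_inv _ hu,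
    Matrix.one_mul, Matrix.nonsing_inv_mul _ hu', Matrix.one_mulVec]
  simp [dotProduct, sq]

/-- Change of variables with Jacobian `|det L| = √(det Om)`. -/
theorem withDensity_eq_map_affine (hOm : Om.PosDef) (hL : Lᵀ * L = Om) (ξ : E d)
    {h : E d → ℝ≥0∞} (hh : Measurable h) :
    volume.withDensity h = (volume.withDensity fun y =>
      ENNReal.ofReal (Real.sqrt Om.det) * h (ξ + act Lᵀ y)).map fun y => ξ + act Lᵀ y := by
  have hdet := det_ne_zero_of_posDef hOm hL
  have hT : Measurable fun y : E d => ξ + act Lᵀ y := (measurable_act Lᵀ).const_add ξ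
  have hvol : (volume : Measure (E d)) =
      ENNReal.ofReal (Real.sqrt Om.det) • volume.map fun y : E d => ξ + act Lᵀ y := by
    have hd' : LinearMap.det (Matrix.toEuclideanLin Lᵀ) ≠ 0 := by
      rwa [det_toEuclideanLin, Matrix.det_transpose]
    have h1 := Measure.map_linearMap_addHaar_eq_smul_addHaar (volume : Measure (E d)) hd'
    have h2 : (volume : Measure (E d)).map (fun y : E d => ξ + act Lᵀ y) =
        (volume.map (Matrix.toEuclideanLin Lᵀ)).map fun z => ξ + z := by
      exact (Measure.map_map (measurable_const_add ξ) (measurable_act Lᵀ)).symm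
    rw [h2, h1, Measure.map_smul, map_add_left_eq_self, smul_smul, det_toEuclideanLin,
      Matrix.det_transpose, sqrt_det_eq_abs_det hL, ← ENNReal.ofReal_mul (abs_nonneg _), abs_inv,
      mul_inv_cancel₀ (abs_ne_zero.2 hdet), ENNReal.ofReal_one, one_smul]
  have hhT : Measurable fun y => h (ξ + act Lᵀ y) := hh.comp hT
  ext s hs
  rw [Measure.map_apply hT hs, withDensity_apply _ hs, withDensity_apply _ (hT hs),
    lintegral_const_mul _ hhT]
  conv_lhs => rw [hvol]
  rw [Measure.restrict_smul, lintegral_smul_measure, smul_eq_mul, setLIntegral_map hs hh hT]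

end LinearChange

/-! ### Spherical and elliptical laws in polar form -/

section Polar

open scoped ENNReal

theorem map_withDensity_comp {α β : Type*} [MeasurableSpace α] [MeasurableSpace β]
    (μ : Measure α) {φ : α → β} (hφ : Measurable φ) {g : β → ℝ≥0∞} (hg : Measurable g) :
    (μ.withDensity fun x => g (φ x)).map φ = (μ.map φ).withDensity g := by
  ext s hs
  rw [Measure.map_apply hφ hs, withDensity_apply _ hs, withDensity_apply _ (hφ hs),
    setLIntegral_map hs hg hφ]

variable {d : ℕ} {ft : ℝ → ℝ}

/-- The standard spherical law with density generator `ft`. -/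
noncomputable def sphericalLaw (d : ℕ) (ft : ℝ → ℝ) : Measure (E d) :=
  volume.withDensity fun y => ENNReal.ofReal (normConst d ft * ft (‖y‖ ^ 2))

/-- The law of the norm of a random vector with law `sphericalLaw d ft`. -/
noncomputable def radiusLaw (d : ℕ) (ft : ℝ → ℝ) : Measure ℝ :=
  (radialMeasure d).withDensity fun r => ENNReal.ofReal (normConst d ft * ft (r ^ 2))

theorem normConst_nonneg (hft : IsDensityGenerator d ft) : 0 ≤ normConst d ft :=
  inv_nonneg.2 hft.pos.le

theorem isProbabilityMeasure_sphericalLaw (hft : IsDensityGenerator d ft) :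
    IsProbabilityMeasure (sphericalLaw d ft) := by
  constructor
  have hpos := hft.pos
  rw [sphericalLaw, withDensity_apply _ .univ, Measure.restrict_univ,
    ← ofReal_integral_eq_lintegral_ofReal (hft.integrable.const_mul _)
      (Filter.Eventually.of_forall fun y =>
        mul_nonneg (normConst_nonneg hft) (hft.nonneg _ (sq_nonneg _))),
    integral_const_mul, normConst, inv_mul_cancel₀ hpos.ne', ENNReal.ofReal_one]

/-- The density depends on the norm alone, so the radial factor absorbs it and the product structure
of Lebesgue measure survives. -/
theorem sphericalLaw_map_polarDecomp (hd : 1 ≤ d) (hft : Measurable ft) :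
    (sphericalLaw d ft).map polarDecomp = (radiusLaw d ft).prod (unifSphere d) := by
  have hq : Measurable fun r : ℝ => ENNReal.ofReal (normConst d ft * ft (r ^ 2)) := by fun_prop
  have hq' : Measurable fun p : ℝ × E d => ENNReal.ofReal (normConst d ft * ft (p.1 ^ 2)) :=
    hq.comp measurable_fst
  rw [radiusLaw, prod_withDensity_left hq, ← volume_map_polarDecomp hd,
    ← map_withDensity_comp _ measurable_polarDecomp hq']
  rfl

theorem isProbabilityMeasure_radiusLaw (hd : 1 ≤ d) (hft : IsDensityGenerator d ft) :
    IsProbabilityMeasure (radiusLaw d ft) := by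
  have := isProbabilityMeasure_sphericalLaw hft
  have := isProbabilityMeasure_unifSphere hd
  have h := DFunLike.congr_fun (sphericalLaw_map_polarDecomp hd hft.measurable) univ
  rw [Measure.map_apply measurable_polarDecomp .univ, preimage_univ, measure_univ,
    ← univ_prod_univ, Measure.prod_prod, measure_univ (μ := unifSphere d), mul_one] at h
  exact ⟨h.symm⟩

theorem radiusLaw_Iic_zero : radiusLaw d ft (Iic 0) = 0 := by
  refine withDensity_absolutelyContinuous _ _ ?_
  rw [radialMeasure, Measure.smul_apply, withDensity_apply _ measurableSet_Iic,
    Measure.restrict_restrict measurableSet_Iic, Iic_inter_Ioi, Ioc_self]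
  simp

variable {Om L : Matrix (Fin d) (Fin d) ℝ}

theorem measurable_ellDensity (ξ : E d) (hft : Measurable ft) : Measurable (ellDensity ξ Om ft) := by
  have := (measurable_quad Om⁻¹).comp (measurable_id.sub_const ξ)
  exact (hft.comp this).const_mul _

theorem sqrt_det_mul_ellDensity (hOm : Om.PosDef) (hL : Lᵀ * L = Om) (ξ y : E d) :
    Real.sqrt Om.det * ellDensity ξ Om ft (ξ + act Lᵀ y) = normConst d ft * ft (‖y‖ ^ 2) := by
  rw [ellDensity, add_sub_cancel_left, quad_inv_act hOm hL]
  have := (Real.sqrt_pos.2 hOm.det_pos).ne'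
  field_simp

theorem ellLaw_eq_map (hOm : Om.PosDef) (hL : Lᵀ * L = Om) (hft : Measurable ft) (ξ : E d) :
    ellLaw ξ Om ft = (sphericalLaw d ft).map fun y => ξ + act Lᵀ y := by
  rw [ellLaw, withDensity_eq_map_affine hOm hL ξ (measurable_ellDensity ξ hft).ennreal_ofReal,
    sphericalLaw]
  congr 2
  funext y
  rw [← ENNReal.ofReal_mul (Real.sqrt_nonneg _), sqrt_det_mul_ellDensity hOm hL]

theorem skewLaw_eq_map (hOm : Om.PosDef) (hL : Lᵀ * L = Om) (hft : IsDensityGenerator d ft)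
    (ξ : E d) {g : E d → ℝ} (hg : Measurable g) :
    volume.withDensity (fun z => ENNReal.ofReal (2 * ellDensity ξ Om ft z * g (z - ξ))) =
      ((sphericalLaw d ft).withDensity fun y => ENNReal.ofReal (2 * g (act Lᵀ y))).map
        fun y => ξ + act Lᵀ y := by
  rw [withDensity_eq_map_affine hOm hL ξ, sphericalLaw, ← withDensity_mul]
  · congr 2
    funext y
    simp only [Pi.mul_apply]
    -- The spherical factor is nonnegative, so the products merge under `ofReal` whatever the sign
    -- of `g`.
    rw [← ENNReal.ofReal_mul (Real.sqrt_nonneg _), add_sub_cancel_left, ← ENNReal.ofReal_mul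
      (mul_nonneg (normConst_nonneg hft) (hft.nonneg _ (sq_nonneg _))),
      ← sqrt_det_mul_ellDensity hOm hL ξ]
    congr 1
    ring
  · have := hft.measurable
    fun_prop
  · exact ((hg.comp (measurable_act Lᵀ)).const_mul 2).ennreal_ofReal
  · exact (((measurable_ellDensity ξ hft.measurable).const_mul 2).mul
      (hg.comp (measurable_id.sub_const ξ))).ennreal_ofReal

theorem norm_smul_inv_norm_smul (y : E d) : ‖y‖ • ‖y‖⁻¹ • y = y := by
  rcases eq_or_ne y 0 with rfl | hy
  · simp
  · exact smul_inv_smul₀ (norm_ne_zero_iff.2 hy) y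

theorem isRadiusLaw_radiusLaw (hd : 1 ≤ d) (hOm : Om.PosDef) (hL : Lᵀ * L = Om)
    (hft : IsDensityGenerator d ft) (ξ : E d) :
    IsRadiusLaw ξ L (ellLaw ξ Om ft) (radiusLaw d ft) := by
  refine ⟨isProbabilityMeasure_radiusLaw hd hft, radiusLaw_Iic_zero, ?_⟩
  have hact := measurable_act Lᵀ
  rw [← sphericalLaw_map_polarDecomp hd hft.measurable,
    Measure.map_map (by fun_prop) measurable_polarDecomp, ellLaw_eq_map hOm hL hft.measurable]
  congr 1
  funext y
  simp only [Function.comp_apply, polarDecomp]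
  rw [← act_smul, norm_smul_inv_norm_smul]

/-- The law of a radius is the image of the elliptical law under the Mahalanobis distance. -/
theorem IsRadiusLaw.eq_map (hd : 1 ≤ d) (hOm : Om.PosDef) (hL : Lᵀ * L = Om) {ξ : E d}
    {μ : Measure (E d)} {ρ : Measure ℝ} (h : IsRadiusLaw ξ L μ ρ) :
    ρ = μ.map fun z => Real.sqrt (quad Om⁻¹ (z - ξ)) := by
  obtain ⟨hρ, hρ0, hμ⟩ := h
  have := isProbabilityMeasure_unifSphere hd
  have hact := measurable_act Lᵀ
  have hq : Measurable fun z => Real.sqrt (quad Om⁻¹ (z - ξ)) :=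
    Real.continuous_sqrt.measurable.comp ((measurable_quad Om⁻¹).comp (measurable_id.sub_const ξ))
  rw [← hμ, Measure.map_map hq (by fun_prop)]
  have hfst : ρ = (ρ.prod (unifSphere d)).map Prod.fst := by
    rw [Measure.map_fst_prod, measure_univ, one_smul]
  conv_lhs => rw [hfst]
  -- Almost surely `r > 0` and `‖s‖ = 1`, and there the Mahalanobis distance of `ξ + r Lᵀ s` is `r`.
  refine Measure.map_congr ?_
  have h1 : ∀ᵐ r ∂ρ, 0 < r := by
    rw [ae_iff]
    simp only [not_lt]
    exact hρ0
  have h1' := Measure.quasiMeasurePreserving_fst.ae (μa := ρ.prod (unifSphere d)) h1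
  have h2' := Measure.quasiMeasurePreserving_snd.ae (μa := ρ.prod (unifSphere d))
    (ae_norm_unifSphere d)
  filter_upwards [h1', h2'] with p hp hs
  simp only [Function.comp_apply, add_sub_cancel_left]
  rw [← act_smul, quad_inv_act hOm hL, Real.sqrt_sq (norm_nonneg _), norm_smul, hs, mul_one,
    Real.norm_of_nonneg hp.le]

end Polar

/-! ### Odd perturbations of the uniform law -/

section SymmetricPerturbation

open scoped ENNReal

variable {d : ℕ}

/-- An odd perturbation of the uniform distribution on the sphere has total mass one. -/
theorem lintegral_two_mul_cdf_odd (hd : 1 ≤ d) {G : ℝ → ℝ} (hGm : Measurable G)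
    (hG0 : ∀ x, 0 ≤ G x) (hG1 : ∀ x, G x ≤ 1) (hG : ∀ x, G (-x) = 1 - G x) {v : E d → ℝ}
    (hv : Measurable v) (hodd : ∀ y, v (-y) = -v y) :
    ∫⁻ s, ENNReal.ofReal (2 * G (v s)) ∂unifSphere d = 1 := by
  have := isProbabilityMeasure_unifSphere hd
  have hm : Measurable fun s => ENNReal.ofReal (2 * G (v s)) := by fun_prop
  -- Reflection `s ↦ -s` shows that the integrals of `2G(v)` and `2(1 - G(v))` agree; their sum is
  -- two.
  have h1 : ∫⁻ s, ENNReal.ofReal (2 * G (v s)) ∂unifSphere d =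
      ∫⁻ s, ENNReal.ofReal (2 * (1 - G (v s))) ∂unifSphere d := by
    conv_lhs => rw [← map_neg_unifSphere d, lintegral_map hm measurable_neg]
    simp only [hodd, hG]
  have h2 : ∫⁻ s, ENNReal.ofReal (2 * G (v s)) ∂unifSphere d +
      ∫⁻ s, ENNReal.ofReal (2 * (1 - G (v s))) ∂unifSphere d = 2 := by
    rw [← lintegral_add_left hm]
    have : ∀ s, ENNReal.ofReal (2 * G (v s)) + ENNReal.ofReal (2 * (1 - G (v s))) = 2 := fun s => by
      rw [← ENNReal.ofReal_add (by linarith [hG0 (v s)]) (by linarith [hG1 (v s)])]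
      rw [show 2 * G (v s) + 2 * (1 - G (v s)) = 2 by ring]
      simp
    rw [lintegral_congr this, lintegral_const, measure_univ, mul_one]
  rw [← h1, ← two_mul] at h2
  exact (ENNReal.mul_right_inj two_ne_zero ENNReal.ofNat_ne_top).1 (h2.trans (mul_one 2).symm)

/-- The factor `2` cancels the one in the surface area `2π^(d/2)/Γ(d/2)`. The densities are compared
only on the box, where the Jacobian is nonnegative. -/
theorem hasSphericalDensity_withDensity (hd : 2 ≤ d) {p : E d → ℝ}
    (hp : Measurable fun s => ENNReal.ofReal (2 * p s)) :
    HasSphericalDensity ((unifSphere d).withDensity fun s => ENNReal.ofReal (2 * p s))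
      (fun θ => Real.Gamma (d / 2) / Real.pi ^ ((d : ℝ) / 2) * angleJacobian θ *
        p (sphPoint θ)) := by
  have hΓ : 0 < Real.Gamma ((d : ℝ) / 2) := Real.Gamma_pos_of_pos (by positivity)
  have hps : Measurable fun θ => ENNReal.ofReal (2 * p (sphPoint (d := d) θ)) :=
    hp.comp measurable_sphPoint
  rw [HasSphericalDensity, unifSphere_eq_map_sphPoint hd,
    ← map_withDensity_comp _ measurable_sphPoint hp, ← withDensity_mul _ _ hps]
  · congr 1
    refine withDensity_congr_ae ?_
    filter_upwards [ae_restrict_mem (measurableSet_angleBox d)] with θ hθ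
    have hJ := angleJacobian_nonneg hθ
    rw [Pi.mul_apply, ← ENNReal.ofReal_mul (by positivity)]
    congr 1
    field_simp
  · exact (measurable_angleJacobian.const_mul _).ennreal_ofReal

end SymmetricPerturbation

/-! ### Marginals and conditional laws from a joint density -/

section Disintegration

open scoped ENNReal

variable {α β : Type*} [MeasurableSpace α] [MeasurableSpace β]

/-- A density relative to a product measure, with total mass one in the second variable, yields a
Markov kernel that disintegrates the measure with this density. -/
theorem exists_kernel_compProd_eq_withDensity (ρ : Measure α) [SFinite ρ] (σ : Measure β)
    [SFinite σ] {k : α → β → ℝ≥0∞} (hk : Measurable (Function.uncurry k))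
    (hmass : ∀ a, ∫⁻ b, k a b ∂σ = 1) :
    ∃ K : Kernel α β, IsMarkovKernel K ∧ (∀ a, K a = σ.withDensity (k a)) ∧
      ρ ⊗ₘ K = (ρ.prod σ).withDensity fun p => k p.1 p.2 := by
  have hK : ∀ a, (Kernel.const α σ).withDensity k a = σ.withDensity (k a) := fun a => by
    rw [Kernel.withDensity_apply _ hk, Kernel.const_apply]
  have hM : IsMarkovKernel ((Kernel.const α σ).withDensity k) := ⟨fun a => ⟨by
    rw [hK, withDensity_apply _ .univ, Measure.restrict_univ, hmass]⟩⟩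
  refine ⟨(Kernel.const α σ).withDensity k, hM, hK, ?_⟩
  change _ = (ρ.prod σ).withDensity (Function.uncurry k)
  ext s hs
  rw [Measure.compProd_apply hs, withDensity_apply _ hs, ← lintegral_indicator hs,
    lintegral_prod _ (hk.indicator hs).aemeasurable]
  refine lintegral_congr fun a => ?_
  have hsa : MeasurableSet (Prod.mk a ⁻¹' s) := measurable_prodMk_left hs
  rw [hK, withDensity_apply _ hsa, ← lintegral_indicator hsa]
  rfl

theorem prod_withDensity_map_snd (ρ : Measure α) [SFinite ρ] (σ : Measure β) [SFinite σ]
    {k : α × β → ℝ≥0∞} (hk : Measurable k) :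
    ((ρ.prod σ).withDensity k).map Prod.snd = σ.withDensity fun s => ∫⁻ r, k (r, s) ∂ρ := by
  ext t ht
  rw [Measure.map_apply measurable_snd ht, withDensity_apply _ (measurable_snd ht),
    withDensity_apply _ ht, ← univ_prod, ← Measure.prod_restrict, Measure.restrict_univ,
    lintegral_prod_symm' _ hk]

/-- If `X` has law `ν` and is independent of `Y`, then `2 Pr{X ≤ v(Y)}` is the mean of `2 G(v(Y))`,
where `G` is the distribution function of `X`. -/
theorem ofReal_two_mul_prod_real_le {Ω : Type*} [MeasurableSpace Ω] (P : Measure Ω)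
    [IsProbabilityMeasure P] (ν : Measure ℝ) [IsProbabilityMeasure ν] {Y : Ω → α}
    (hY : Measurable Y) {v : α → ℝ} (hv : Measurable v) :
    ENNReal.ofReal (2 * (P.prod ν).real {p | p.2 ≤ v (Y p.1)}) =
      ∫⁻ y, ENNReal.ofReal (2 * cdf ν (v y)) ∂(P.map Y) := by
  have hc : Measurable (cdf ν) := (monotone_cdf ν).measurable
  have hS : MeasurableSet {p : Ω × ℝ | p.2 ≤ v (Y p.1)} :=
    measurableSet_le measurable_snd (hv.comp (hY.comp measurable_fst))
  simp only [ENNReal.ofReal_mul zero_le_two]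
  rw [lintegral_const_mul _ (by fun_prop), lintegral_map (by fun_prop) hY, ofReal_measureReal,
    Measure.prod_apply hS]
  simp only [ofReal_cdf]
  rfl

end Disintegration

/-! ### The joint law of radius and direction -/

section SphericalPart

variable {d : ℕ}

theorem measurable_wL {w : E d → ℝ} (hw : Measurable w) (L : Matrix (Fin d) (Fin d) ℝ) :
    Measurable (wL w L) := hw.comp (measurable_act Lᵀ)

theorem wL_smul_neg {w : E d → ℝ} (hodd : ∀ y, w (-y) = -w y) (L : Matrix (Fin d) (Fin d) ℝ)
    (r : ℝ) (y : E d) : wL w L (r • -y) = -wL w L (r • y) := by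
  rw [wL, wL, smul_neg, act_neg, hodd]

/-- The law of the polar decomposition of a perturbed spherical law. -/
theorem sphericalLaw_withDensity_map_polarDecomp (hd : 1 ≤ d) {ft : ℝ → ℝ} (hft : Measurable ft)
    {g : E d → ENNReal} (hg : Measurable g) :
    ((sphericalLaw d ft).withDensity g).map polarDecomp =
      ((radiusLaw d ft).prod (unifSphere d)).withDensity fun p => g (p.1 • p.2) := by
  rw [← sphericalLaw_map_polarDecomp hd hft, ← map_withDensity_comp _ measurable_polarDecomp
    (by fun_prop)]
  simp only [polarDecomp, norm_smul_inv_norm_smul]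

/-- A random vector without atom at the origin is the product of a positive radius and a point of
the unit sphere. -/
theorem exists_radius_direction (hd : 1 ≤ d) {Ω : Type*} [MeasurableSpace Ω] (P : Measure Ω)
    {Y : Ω → E d} (hY : Measurable Y) (hY0 : ∀ᵐ ω ∂P, Y ω ≠ 0) :
    ∃ (R : Ω → ℝ) (S' : Ω → E d), Measurable R ∧ Measurable S' ∧ (∀ ω, 0 < R ω) ∧
      (∀ ω, ‖S' ω‖ = 1) ∧ ∀ᵐ ω ∂P, (R ω, S' ω) = polarDecomp (Y ω) := by
  classical
  have hms : MeasurableSet {ω | Y ω = 0} := hY (measurableSet_singleton 0)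
  -- On the null event `Y = 0`, radius `1` and the first basis vector serve as default values, so
  -- positivity and unit norm hold everywhere.
  refine ⟨fun ω => if Y ω = 0 then 1 else ‖Y ω‖,
    fun ω => if Y ω = 0 then EuclideanSpace.single ⟨0, hd⟩ 1 else ‖Y ω‖⁻¹ • Y ω,
    Measurable.ite hms measurable_const hY.norm,
    Measurable.ite hms measurable_const (hY.norm.inv.smul hY), fun ω => ?_, fun ω => ?_, ?_⟩
  · by_cases h : Y ω = 0
    · simp [h]
    · simp [h]
  · by_cases h : Y ω = 0
    · simp [h]
    · simp [h, norm_smul]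
  · filter_upwards [hY0] with ω hω
    simp [hω, polarDecomp]

/-- The stochastic representation of a skew-elliptical random vector, with the joint law of the
radius and the direction. -/
theorem exists_stochastic_representation (hd : 1 ≤ d) (ξ : E d)
    {Om L : Matrix (Fin d) (Fin d) ℝ} (hOm : Om.PosDef) (hL : Lᵀ * L = Om)
    {ft : ℝ → ℝ} (hft : IsDensityGenerator d ft) {G : ℝ → ℝ} (hG : Measurable G)
    {w : E d → ℝ} (hw : Measurable w)
    {Ω : Type*} [MeasurableSpace Ω] (P : Measure Ω) {Z : Ω → E d} (hZ : Measurable Z)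
    (hZd : P.map Z = volume.withDensity
      (fun z => ENNReal.ofReal (2 * ellDensity ξ Om ft z * G (w (z - ξ))))) :
    ∃ (R : Ω → ℝ) (S' : Ω → E d), Measurable R ∧ Measurable S' ∧
      (∀ ω, 0 < R ω) ∧ (∀ ω, ‖S' ω‖ = 1) ∧
      (∀ᵐ ω ∂P, Z ω = ξ + R ω • act Lᵀ (S' ω)) ∧
      P.map (fun ω => (R ω, S' ω)) = ((radiusLaw d ft).prod (unifSphere d)).withDensity
        fun p => ENNReal.ofReal (2 * G (wL w L (p.1 • p.2))) := by
  have hdet : IsUnit Lᵀ.det := by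
    rw [Matrix.det_transpose]
    exact isUnit_iff_ne_zero.2 (det_ne_zero_of_posDef hOm hL)
  have hwL := measurable_wL hw L
  have hact := measurable_act Lᵀ
  have hact' := measurable_act Lᵀ⁻¹
  have hg : Measurable fun y => ENNReal.ofReal (2 * G (wL w L y)) := by fun_prop
  have hinv : Measurable fun z => act Lᵀ⁻¹ (z - ξ) := hact'.comp (measurable_id.sub_const ξ)
  obtain ⟨Y, hYdef⟩ : ∃ Y : Ω → E d, Y = fun ω => act Lᵀ⁻¹ (Z ω - ξ) := ⟨_, rfl⟩
  have hY : Measurable Y := hYdef ▸ hinv.comp hZ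
  have hZY : ∀ ω, Z ω = ξ + act Lᵀ (Y ω) := fun ω => by
    rw [hYdef, act_act, Matrix.mul_nonsing_inv _ hdet, act_one, add_sub_cancel]
  have hYlaw : P.map Y = (sphericalLaw d ft).withDensity
      fun y => ENNReal.ofReal (2 * G (wL w L y)) := by
    have h1 : P.map Y = (P.map Z).map fun z => act Lᵀ⁻¹ (z - ξ) := by
      rw [hYdef, Measure.map_map hinv hZ]
      rfl
    rw [h1, hZd, skewLaw_eq_map hOm hL hft ξ (g := fun y => G (w y)) (hG.comp hw),
      Measure.map_map hinv (hact.const_add ξ)]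
    refine Eq.trans ?_ Measure.map_id
    congr 1
    funext y
    simp only [Function.comp_apply, add_sub_cancel_left, act_act, Matrix.nonsing_inv_mul _ hdet,
      act_one, id_eq]
  -- The law of `Y` is absolutely continuous, and points are Lebesgue-null because `d ≥ 1`.
  have hY0 : ∀ᵐ ω ∂P, Y ω ≠ 0 := by
    have : Nonempty (Fin d) := ⟨⟨0, hd⟩⟩
    have hac : P.map Y ≪ volume := by
      rw [hYlaw]
      exact (withDensity_absolutelyContinuous _ _).trans (withDensity_absolutelyContinuous _ _)
    exact ae_of_ae_map hY.aemeasurable (hac.ae_le (Measure.ae_ne volume 0))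
  obtain ⟨R, S', hR, hS', hRpos, hSnorm, hRS⟩ := exists_radius_direction hd P hY hY0
  refine ⟨R, S', hR, hS', hRpos, hSnorm, ?_, ?_⟩
  · filter_upwards [hRS] with ω hω
    obtain ⟨h1, h2⟩ := Prod.ext_iff.1 hω
    simp only [polarDecomp] at h1 h2
    rw [hZY, h1, h2, ← act_smul, norm_smul_inv_norm_smul]
  · rw [Measure.map_congr hRS, ← sphericalLaw_withDensity_map_polarDecomp hd hft.measurable hg,
      ← hYlaw, Measure.map_map measurable_polarDecomp hY]
    rfl

end SphericalPart

/-! ### The theorem -/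

theorem proposition8 (d : ℕ) (hd : 1 ≤ d)
    (ξ : E d) (Om : Matrix (Fin d) (Fin d) ℝ) (hOm : Om.PosDef)
    (ft : ℝ → ℝ) (hft : IsDensityGenerator d ft)
    -- `νX` is the law of `X`, and `G = cdf νX` its distribution function
    (νX : Measure ℝ) [IsProbabilityMeasure νX]
    (hG : ∀ x, cdf νX (-x) = 1 - cdf νX x)
    (w : E d → ℝ) (hw : Measurable w) (hodd : ∀ y, w (-y) = -w y)
    {Ω : Type*} [MeasurableSpace Ω] (P : Measure Ω) [IsProbabilityMeasure P]
    (Z : Ω → E d) (hZ : Measurable Z)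
    (hZd : P.map Z = volume.withDensity
      (fun z => ENNReal.ofReal (2 * ellDensity ξ Om ft z * cdf νX (w (z - ξ)))))
    (L : Matrix (Fin d) (Fin d) ℝ) (hL : Lᵀ * L = Om) :
    ∃ (R : Ω → ℝ) (S' : Ω → E d), Measurable R ∧ Measurable S' ∧
      -- the stochastic representation
      (∀ ω, 0 < R ω) ∧ (∀ ω, ‖S' ω‖ = 1) ∧
      (∀ᵐ ω ∂P, Z ω = ξ + R ω • act Lᵀ (S' ω)) ∧
      -- `R` has the law of the radius of `U`
      IsRadiusLaw ξ L (ellLaw ξ Om ft) (P.map R) ∧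
      (∀ (L' : Matrix (Fin d) (Fin d) ℝ) (ρ : Measure ℝ), L'ᵀ * L' = Om →
        IsRadiusLaw ξ L' (ellLaw ξ Om ft) ρ → P.map R = ρ) ∧
      -- the law of `S'` relative to the uniform law; when it is uniform
      P.map S' = (unifSphere d).withDensity (fun s =>
        ENNReal.ofReal (2 * (P.prod νX).real {p | p.2 ≤ wL w L (R p.1 • s)})) ∧
      (P.map S' = unifSphere d ↔
        ∀ᵐ s ∂(unifSphere d), (P.prod νX).real {p | p.2 ≤ wL w L (R p.1 • s)} = 1 / 2) ∧
      -- the density of `S'` in spherical coordinates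
      (2 ≤ d → HasSphericalDensity (P.map S') (fun θ =>
        Real.Gamma (d / 2) / Real.pi ^ ((d : ℝ) / 2) * angleJacobian θ *
          (P.prod νX).real {p | p.2 ≤ wLStar w L θ (R p.1)})) ∧
      -- the conditional law of `S'` given `R = r`
      (∀ᵐ r ∂(P.map R),
        IsSymmetricPerturbation (unifSphere d) (cdf νX) (fun s => wL w L (r • s))
          (condDistrib S' R P r) ∧
        (2 ≤ d → HasSphericalDensity (condDistrib S' R P r) (fun θ =>
          Real.Gamma (d / 2) / Real.pi ^ ((d : ℝ) / 2) * angleJacobian θ *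
            cdf νX (wLStar w L θ r)))) := by
  have hσ := isProbabilityMeasure_unifSphere hd
  have hρ := isProbabilityMeasure_radiusLaw hd hft
  have hG' : Measurable (cdf νX) := (monotone_cdf νX).measurable
  have hwL := measurable_wL hw L
  have hk : Measurable fun p : ℝ × E d => ENNReal.ofReal (2 * cdf νX (wL w L (p.1 • p.2))) := by
    fun_prop
  obtain ⟨R, S', hR, hS', hRpos, hSnorm, hRS, hJ⟩ :=
    exists_stochastic_representation hd ξ hOm hL hft hG' hw P hZ hZd
  have hmass : ∀ r : ℝ, ∫⁻ s, ENNReal.ofReal (2 * cdf νX (wL w L (r • s))) ∂unifSphere d = 1 :=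
    fun r => lintegral_two_mul_cdf_odd hd hG' (cdf_nonneg νX) (cdf_le_one νX) hG
      (v := fun s => wL w L (r • s)) (by fun_prop) (wL_smul_neg hodd L r)
  obtain ⟨K, hKm, hK, hKJ⟩ := exists_kernel_compProd_eq_withDensity (radiusLaw d ft)
    (unifSphere d) (k := fun r s => ENNReal.ofReal (2 * cdf νX (wL w L (r • s)))) hk hmass
  have hJK : P.map (fun ω => (R ω, S' ω)) = radiusLaw d ft ⊗ₘ K := hJ.trans hKJ.symm
  -- Since `K` is Markov, the perturbation leaves the first marginal unchanged.
  have hRlaw : P.map R = radiusLaw d ft := by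
    rw [← Measure.fst_compProd (radiusLaw d ft) K, ← hJK, Measure.fst_map_prodMk hS']
  have hrad : IsRadiusLaw ξ L (ellLaw ξ Om ft) (P.map R) := by
    rw [hRlaw]
    exact isRadiusLaw_radiusLaw hd hOm hL hft ξ
  have hprob : ∀ s : E d, ENNReal.ofReal (2 * (P.prod νX).real {p | p.2 ≤ wL w L (R p.1 • s)}) =
      ∫⁻ r, ENNReal.ofReal (2 * cdf νX (wL w L (r • s))) ∂radiusLaw d ft := fun s => by
    rw [← hRlaw]
    exact ofReal_two_mul_prod_real_le P νX hR (v := fun r => wL w L (r • s)) (by fun_prop)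
  have hprobm : Measurable fun s : E d =>
      ENNReal.ofReal (2 * (P.prod νX).real {p | p.2 ≤ wL w L (R p.1 • s)}) := by
    simp only [hprob]
    exact hk.lintegral_prod_left'
  have hSlaw : P.map S' = (unifSphere d).withDensity fun s =>
      ENNReal.ofReal (2 * (P.prod νX).real {p | p.2 ≤ wL w L (R p.1 • s)}) := by
    simp only [hprob]
    rw [← prod_withDensity_map_snd _ _ hk, ← hJ, Measure.map_map measurable_snd (hR.prodMk hS')]
    rfl
  refine ⟨R, S', hR, hS', hRpos, hSnorm, hRS, hrad, fun L' ρ hL' hρ' => ?_, hSlaw, ?_, fun hd2 => ?_,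
    ?_⟩
  -- Both are images of the same elliptical law under a map that involves `ξ` and `Om` but not the
  -- chosen square root.
  · rw [hrad.eq_map hd hOm hL, hρ'.eq_map hd hOm hL']
  -- Densities relative to a σ-finite measure are unique almost everywhere, so uniformity means that
  -- the density is `1`.
  · have h1 : unifSphere d = (unifSphere d).withDensity 1 := withDensity_one.symm
    conv_lhs => rw [hSlaw]; rhs; rw [h1]
    rw [withDensity_eq_iff_of_sigmaFinite hprobm.aemeasurable measurable_one.aemeasurable]
    refine Filter.eventually_congr (Filter.Eventually.of_forall fun s => ?_)
    rw [Pi.one_apply, ENNReal.ofReal_eq_one]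
    constructor <;> intro h <;> linarith
  · rw [hSlaw]
    exact hasSphericalDensity_withDensity hd2 hprobm
  -- A disintegration of the joint law is unique up to null sets of radii, so `K` is the conditional
  -- law.
  · filter_upwards [condDistrib_ae_eq_of_measure_eq_compProd R hS'.aemeasurable
      (hJK.trans (by rw [hRlaw]))] with r hr
    have hrm : Measurable fun s : E d => wL w L (r • s) := by fun_prop
    rw [hr]
    refine ⟨⟨hσ, map_neg_unifSphere d, hrm, fun y => ?_, inferInstance, hK r⟩, fun hd2 => ?_⟩
    · exact wL_smul_neg hodd L r y
    · rw [hK r]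
      exact hasSphericalDensity_withDensity hd2 (p := fun s => cdf νX (wL w L (r • s)))
        (by fun_prop)
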